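/- **Theorem 3.3.** All Banach analytic manifolds are complex analytic manifolds modelled on a complex Banach space. For Banach analytic manifolds $A$ and $X$, let $\mathrm{Hol}(A,X)$ be the set of holomorphic maps $A\to X$ with the compact-open topology. For $S\subset A$, let $S^u$ be the set of all $z\in\overline S$ such that for every connected open neighbourhood $U$ of $z$, every holomorphic function $g:U\to\mathbb C$ with $g|_{U\cap S}=0$ is identically $0$ on $U$. For a sequence $\{f_k\}\subset \mathrm{Hol}(A,X)$, let $Z_{\{f_k\}}$ be the set of all $a\in A$ such that $\{f_k(a)\}$ converges in $X$. Let $\Delta$ be the open unit disc and $\rho_\Delta$ its Poincaré distance. For $x,y\in X$, the Kobayashi pseudo-distance $\kappa_X(x,y)\in[0,\infty]$ is the infimum of $\sum_{i=1}^n\rho_\Delta(a_i,b_i)$ over all finite chains of points $x=p_0,p_1,\dots,p_n=y$ of $X$, points $a_i,b_i\in\Delta$ and holomorphic maps $h_i:\Delta\to X$ with $h_i(a_i)=p_{i-1}$ and $h_i(b_i)=p_i$ ($1\le i\le n$); it is $\infty$ if there is no such chain. The manifold $X$ is *hyperbolic* if $\kappa_X(x,y)=0$ only for $x=y$ and $\kappa_X$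 defines the topology of $X$. It is *complete hyperbolic* if, in addition, every $\kappa_X$-Cauchy sequence in $X$ converges in $X$. The manifold $X$ has the *strong Vitali property* if for every connected Banach analytic manifold $A$ and every sequence $\{f_k\}\subset\mathrm{Hol}(A,X)$ with $(Z_{\{f_k\}})^u\neq\emptyset$, the sequence $\{f_k\}$ converges in $\mathrm{Hol}(A,X)$, i.e. there is a holomorphic map $f:A\to X$ such that $f_k\to f$ in the compact-open topology. Then every complete hyperbolic Banach analytic manifold has the strong Vitali property. In particular, every compact hyperbolic Banach analytic manifold has the strong Vitali property. -/

import Mathlib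

open Set Filter Topology
open scoped Manifold ContDiff ENNReal

universe u v w t

noncomputable section

/-- The space of holomorphic maps from the Banach analytic manifold `A` (modelled on `F`) to the
Banach analytic manifold `X` (modelled on `E`).  As a subtype of `C(A, X)` it carries the
compact-open topology. -/
abbrev Hol (F A E X : Type*)
    [NormedAddCommGroup F] [NormedSpace ℂ F] [TopologicalSpace A] [ChartedSpace F A]
    [NormedAddCommGroup E] [NormedSpace ℂ E] [TopologicalSpace X] [ChartedSpace E X] : Type _ :=
  {f : C(A, X) // MDifferentiable 𝓘(ℂ, F) 𝓘(ℂ, E) f}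

/-- The points of `A` at which the sequence of maps `f` converges pointwise. -/
def convergenceSet {A X : Type*} [TopologicalSpace X] (f : ℕ → A → X) : Set A :=
  {a | ∃ x, Tendsto (fun k => f k a) atTop (𝓝 x)}

/-- The uniqueness part `Sᵘ` of a subset `S` of the manifold `A`: the points `z` in the closure
of `S` such that, on every connected open neighbourhood `U` of `z`, the only holomorphic function
`U → ℂ` vanishing on `U ∩ S` is the zero function.  (Values of `g` outside `U` play no role.) -/
def uniquenessPart (F : Type*) {A : Type*} [NormedAddCommGroup F] [NormedSpace ℂ F]
    [TopologicalSpace A] [ChartedSpace F A] (S : Set A) : Set A :=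
  {z | z ∈ closure S ∧
    ∀ U : Set A, IsOpen U → IsConnected U → z ∈ U →
      ∀ g : A → ℂ, MDifferentiableOn 𝓘(ℂ, F) 𝓘(ℂ, ℂ) g U →
        (∀ a ∈ U ∩ S, g a = 0) → ∀ a ∈ U, g a = 0}

/-- The Poincaré distance of two points of the open unit disc (curvature `-1`): it equals
`log ((1 + δ) / (1 - δ))` where `δ = |a - b| / |1 - conj a * b|`. -/
def poincareDist (a b : ℂ) : ℝ :=
  Real.log ((1 + ‖(a - b) / (1 - (starRingEnd ℂ) a * b)‖) /
    (1 - ‖(a - b) / (1 - (starRingEnd ℂ) a * b)‖))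

/-- `p 0, …, p n`, `a i, b i` and `f i` (for `i < n`) form a holomorphic chain from `x` to `y`:
each `f i` is a holomorphic map from the unit disc to `X` with `f i (a i) = p i` and
`f i (b i) = p (i + 1)`.  (Values for larger indices and outside the disc play no role.) -/
structure IsHolChain (E : Type*) {X : Type*} [NormedAddCommGroup E] [NormedSpace ℂ E]
    [TopologicalSpace X] [ChartedSpace E X] (x y : X) (n : ℕ)
    (p : ℕ → X) (a b : ℕ → ℂ) (f : ℕ → ℂ → X) : Prop where
  start : p 0 = x
  finish : p n = y
  left_mem : ∀ i < n, a i ∈ Metric.ball (0 : ℂ) 1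
  right_mem : ∀ i < n, b i ∈ Metric.ball (0 : ℂ) 1
  holo : ∀ i < n, MDifferentiableOn 𝓘(ℂ, ℂ) 𝓘(ℂ, E) (f i) (Metric.ball (0 : ℂ) 1)
  left_eq : ∀ i < n, f i (a i) = p i
  right_eq : ∀ i < n, f i (b i) = p (i + 1)

/-- The Kobayashi pseudo-distance: the infimum of the lengths of all holomorphic chains from `x`
to `y`.  It is `∞` when there is no chain, i.e. when `x` and `y` lie in different components. -/
def kobayashiDist (E : Type*) {X : Type*} [NormedAddCommGroup E] [NormedSpace ℂ E]
    [TopologicalSpace X] [ChartedSpace E X] (x y : X) : ℝ≥0∞ :=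
  sInf {L | ∃ (n : ℕ) (p : ℕ → X) (a b : ℕ → ℂ) (f : ℕ → ℂ → X),
    IsHolChain E x y n p a b f ∧
      L = ENNReal.ofReal (∑ i ∈ Finset.range n, poincareDist (a i) (b i))}

/-- `X` is hyperbolic: the Kobayashi pseudo-distance separates points (symmetry and the triangle
inequality are automatic), and its open balls define the topology of `X`. -/
structure IsHyperbolic (E X : Type*) [NormedAddCommGroup E] [NormedSpace ℂ E]
    [TopologicalSpace X] [ChartedSpace E X] : Prop where
  eq_of_dist_eq_zero : ∀ x y : X, kobayashiDist E x y = 0 → x = y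
  isOpen_iff : ∀ s : Set X,
    IsOpen s ↔ ∀ x ∈ s, ∃ ε : ℝ≥0∞, 0 < ε ∧ {y | kobayashiDist E x y < ε} ⊆ s

/-- `X` is complete hyperbolic: it is hyperbolic and every sequence which is Cauchy for the
Kobayashi distance converges in `X`. -/
structure IsCompleteHyperbolic (E X : Type*) [NormedAddCommGroup E] [NormedSpace ℂ E]
    [TopologicalSpace X] [ChartedSpace E X] : Prop extends IsHyperbolic E X where
  exists_lim : ∀ u : ℕ → X,
    (∀ ε : ℝ≥0∞, 0 < ε → ∃ N, ∀ m ≥ N, ∀ n ≥ N, kobayashiDist E (u m) (u n) < ε) →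
      ∃ x, Tendsto u atTop (𝓝 x)

/-- The strong Vitali property of `X`: for every connected Banach analytic manifold `A` and every
sequence in `Hol(A, X)` whose pointwise convergence set has nonempty uniqueness part, the sequence
converges in `Hol(A, X)` (in the compact-open topology). -/
def StrongVitali (E : Type u) (X : Type v) [NormedAddCommGroup E] [NormedSpace ℂ E]
    [TopologicalSpace X] [ChartedSpace E X] : Prop :=
  ∀ (F : Type w) [NormedAddCommGroup F] [NormedSpace ℂ F] [CompleteSpace F]
    (A : Type t) [TopologicalSpace A] [ChartedSpace F A] [IsManifold 𝓘(ℂ, F) ω A]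
    [ConnectedSpace A] (f : ℕ → Hol F A E X),
    (uniquenessPart F (convergenceSet fun k a => (f k).1 a)).Nonempty →
      ∃ g : Hol F A E X, Tendsto f atTop (𝓝 g)

end

/-!
Why a complete hyperbolic manifold `X` has the strong Vitali property.

Holomorphic maps decrease the Kobayashi distance, and near a point `a` of `A` the discs in a chart
bound that distance by the Poincaré distance. Hence all of `Hol(A, X)` is equicontinuous at `a` for
the metric `kobayashiDist` on `X` (`eventually_kobayashiDist_lt`). As `X` is complete for this
metric, the set `Z` of points of convergence of a sequence `f k` is closed
(`Equicontinuous.isClosed_convergenceSet`), and once `Z` is all of `A` the convergence is locally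
uniform (`Equicontinuous.tendstoLocallyUniformly`).

Near a point of `Z`, equicontinuity confines the tail of the sequence to one chart of `X`, where it
is a bounded sequence of holomorphic maps between Banach spaces
(`Equicontinuous.exists_local_representation`). Such a sequence is a single holomorphic map into the
space of bounded sequences (`exists_hasFDerivAt_boundedSeq`), by a Taylor estimate that depends only
on the bound. Modulo the closed subspace of convergent sequences this map vanishes on `Z`; if `Z` is
a set of uniqueness for scalar functions, it vanishes identically by the Hahn-Banach theorem, and
the sequence converges on a neighbourhood (`exists_tendsto_of_uniqueness`). This applies at a point
of the uniqueness part of `Z`, so `Z` has nonempty interior, and by the identity theorem it applies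
at every limit point of the interior, which is therefore open and closed.

The pointwise limit is holomorphic by `differentiableOn_of_tendsto`. In infinite dimension a locally
uniform limit need not be uniform on any ball, so derivatives converge only pointwise there.

A compact space is complete for every metric defining its topology, which gives the second part.
-/

/-! ### The Kobayashi pseudo-distance -/

lemma poincareDist_nonneg (a b : ℂ) : 0 ≤ poincareDist a b := by
  unfold poincareDist
  set δ := ‖(a - b) / (1 - (starRingEnd ℂ) a * b)‖
  have hδ : 0 ≤ δ := norm_nonneg _
  rw [← Real.log_abs]
  -- Inside the disc `δ < 1`. For `δ ≥ 1` the claim holds by the conventions `x / 0 = 0`,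
  -- `Real.log 0 = 0` and `Real.log x = Real.log |x|`, so no hypothesis on `a`, `b` is needed.
  by_cases h : 1 - δ = 0
  · simp [h]
  · apply Real.log_nonneg
    rw [abs_div, one_le_div (abs_pos.mpr h)]
    rw [abs_of_nonneg (by linarith : 0 ≤ 1 + δ), abs_le]
    constructor <;> linarith

lemma poincareDist_comm (a b : ℂ) : poincareDist a b = poincareDist b a := by
  have h : ‖(a - b) / (1 - (starRingEnd ℂ) a * b)‖ = ‖(b - a) / (1 - (starRingEnd ℂ) b * a)‖ := by
    rw [norm_div, norm_div, norm_sub_rev a b, ← Complex.norm_conj (1 - (starRingEnd ℂ) a * b)]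
    simp [mul_comm]
  simp only [poincareDist, h]

lemma poincareDist_zero_ofReal {s : ℝ} (hs : 0 ≤ s) :
    poincareDist 0 (s : ℂ) = Real.log ((1 + s) / (1 - s)) := by
  simp [poincareDist, abs_of_nonneg hs]

section Kobayashi

variable {E : Type*} {X : Type*} [NormedAddCommGroup E] [NormedSpace ℂ E]
  [TopologicalSpace X] [ChartedSpace E X]

lemma kobayashiDist_le_of_chain {x y : X} {n : ℕ} {p : ℕ → X} {a b : ℕ → ℂ} {f : ℕ → ℂ → X}
    (h : IsHolChain E x y n p a b f) :
    kobayashiDist E x y ≤ ENNReal.ofReal (∑ i ∈ Finset.range n, poincareDist (a i) (b i)) :=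
  sInf_le ⟨n, p, a, b, f, h, rfl⟩

lemma kobayashiDist_self (x : X) : kobayashiDist E x x = 0 := by
  have h : IsHolChain E x x 0 (fun _ => x) (fun _ => 0) (fun _ => 0) (fun _ _ => x) := by
    constructor <;> simp
  simpa using kobayashiDist_le_of_chain h

lemma kobayashiDist_le_poincareDist {h : ℂ → X}
    (hh : MDifferentiableOn 𝓘(ℂ, ℂ) 𝓘(ℂ, E) h (Metric.ball (0 : ℂ) 1))
    {a b : ℂ} (ha : a ∈ Metric.ball (0 : ℂ) 1) (hb : b ∈ Metric.ball (0 : ℂ) 1) :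
    kobayashiDist E (h a) (h b) ≤ ENNReal.ofReal (poincareDist a b) := by
  have hc : IsHolChain E (h a) (h b) 1 (fun i => if i = 0 then h a else h b)
      (fun _ => a) (fun _ => b) (fun _ => h) := by
    constructor <;> simp_all
  simpa using kobayashiDist_le_of_chain hc

lemma IsHolChain.reverse {x y : X} {n : ℕ} {p : ℕ → X} {a b : ℕ → ℂ} {f : ℕ → ℂ → X}
    (h : IsHolChain E x y n p a b f) :
    IsHolChain E y x n (fun i => p (n - i)) (fun i => b (n - 1 - i)) (fun i => a (n - 1 - i))
      (fun i => f (n - 1 - i)) where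
  start := by simpa using h.finish
  finish := by simpa using h.start
  left_mem i hi := h.right_mem _ (by omega)
  right_mem i hi := h.left_mem _ (by omega)
  holo i hi := h.holo _ (by omega)
  left_eq i hi := by
    have := h.right_eq (n - 1 - i) (by omega)
    rwa [show n - 1 - i + 1 = n - i by omega] at this
  right_eq i hi := by
    have := h.left_eq (n - 1 - i) (by omega)
    rwa [show n - 1 - i = n - (i + 1) by omega] at this ⊢

lemma IsHolChain.append {x y z : X} {n m : ℕ} {p q : ℕ → X} {a b c d : ℕ → ℂ}
    {f g : ℕ → ℂ → X} (h : IsHolChain E x y n p a b f) (k : IsHolChain E y z m q c d g) :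
    IsHolChain E x z (n + m) (fun i => if i < n then p i else q (i - n))
      (fun i => if i < n then a i else c (i - n)) (fun i => if i < n then b i else d (i - n))
      (fun i => if i < n then f i else g (i - n)) where
  start := by
    rcases Nat.eq_zero_or_pos n with rfl | hn
    · simpa using k.start.trans (h.finish.symm.trans h.start)
    · simpa [hn] using h.start
  finish := by simpa using k.finish
  left_mem i hi := by
    split_ifs with hin
    exacts [h.left_mem i hin, k.left_mem _ (by omega)]
  right_mem i hi := by
    split_ifs with hin
    exacts [h.right_mem i hin, k.right_mem _ (by omega)]
  holo i hi := by
    split_ifs with hin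
    exacts [h.holo i hin, k.holo _ (by omega)]
  left_eq i hi := by
    split_ifs with hin
    exacts [h.left_eq i hin, k.left_eq _ (by omega)]
  right_eq i hi := by
    rcases lt_trichotomy (i + 1) n with hin | hin | hin
    · simpa [hin, show i < n by omega] using h.right_eq i (by omega)
    · -- The junction of the two chains.
      have := h.right_eq i (by omega)
      rw [hin, h.finish] at this
      simpa [hin, show i < n by omega, k.start] using this
    · have := k.right_eq (i - n) (by omega)
      simpa [show ¬ i < n by omega, show ¬ i + 1 < n by omega,
        show i - n + 1 = i + 1 - n by omega] using this

lemma kobayashiDist_comm (x y : X) : kobayashiDist E x y = kobayashiDist E y x := by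
  suffices H : ∀ x y : X, kobayashiDist E x y ≤ kobayashiDist E y x from (H x y).antisymm (H y x)
  intro x y
  refine le_sInf ?_
  rintro _ ⟨n, p, a, b, f, h, rfl⟩
  refine (kobayashiDist_le_of_chain h.reverse).trans_eq ?_
  rw [← Finset.sum_range_reflect (fun i => poincareDist (a i) (b i))]
  simp only [poincareDist_comm]

lemma kobayashiDist_triangle (x y z : X) :
    kobayashiDist E x z ≤ kobayashiDist E x y + kobayashiDist E y z := by
  conv_rhs => rw [kobayashiDist, ENNReal.sInf_add]
  refine le_iInf₂ ?_
  rintro _ ⟨n, p, a, b, f, h, rfl⟩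
  rw [kobayashiDist, kobayashiDist, ENNReal.add_sInf]
  refine le_iInf₂ ?_
  rintro _ ⟨m, q, c, d, g, k, rfl⟩
  refine (kobayashiDist_le_of_chain (h.append k)).trans_eq ?_
  rw [← ENNReal.ofReal_add (Finset.sum_nonneg fun _ _ => poincareDist_nonneg _ _)
    (Finset.sum_nonneg fun _ _ => poincareDist_nonneg _ _), Finset.sum_range_add]
  congr 2
  · refine Finset.sum_congr rfl fun i hi => ?_
    simp [Finset.mem_range.mp hi]
  · simp

/-- The Kobayashi distance of a hyperbolic manifold as an extended metric; the given topology is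
kept as the underlying one. -/
noncomputable abbrev IsHyperbolic.emetricSpace (hX : IsHyperbolic E X) : EMetricSpace X :=
  EMetricSpace.replaceTopology
    { edist := kobayashiDist E
      edist_self := kobayashiDist_self
      edist_comm := kobayashiDist_comm
      edist_triangle := kobayashiDist_triangle
      eq_of_edist_eq_zero := fun {x y} h => hX.eq_of_dist_eq_zero x y h } <| by
    refine TopologicalSpace.ext_iff.mpr fun s => (hX.isOpen_iff s).trans ?_
    rw [@EMetric.isOpen_iff]
    refine forall₂_congr fun x _ => exists_congr fun ε => and_congr_right fun _ => ?_
    simp only [Set.subset_def, Metric.mem_eball, Set.mem_ofPred_eq]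
    exact forall_congr' fun y => by rw [kobayashiDist_comm]; rfl

end Kobayashi

/-! ### Bounded families of holomorphic maps between Banach spaces -/

section Banach

variable {E F : Type*} [NormedAddCommGroup E] [NormedSpace ℂ E]
  [NormedAddCommGroup F] [NormedSpace ℂ F]

/-- Cauchy's estimate for the first derivative. -/
lemma norm_fderiv_le_of_bounded {f : F → E} {c : F} {R M : ℝ} (hR : 0 < R)
    (hf : DifferentiableOn ℂ f (Metric.ball c R)) (hM : ∀ w ∈ Metric.ball c R, ‖f w‖ ≤ M) :
    ‖fderiv ℂ f c‖ ≤ 2 * M / R := by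
  refine Complex.norm_fderiv_le_div_of_mapsTo_ball hf (fun w hw => ?_) hR
  rw [mem_closedBall_iff_norm]
  linarith [norm_sub_le (f w) (f c), hM w hw, hM c (Metric.mem_ball_self hR)]

/-- A second order Taylor estimate with a constant depending only on the radius and the bound, so
that it holds uniformly over bounded families. -/
lemma norm_sub_sub_fderiv_le_of_bounded {f : F → E} {c w : F} {R M : ℝ} (hR : 0 < R)
    (hf : DifferentiableOn ℂ f (Metric.ball c R)) (hM : ∀ w ∈ Metric.ball c R, ‖f w‖ ≤ M)
    (hw : w ∈ Metric.ball c R) :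
    ‖f w - f c - fderiv ℂ f c (w - c)‖ ≤ 4 * M / R ^ 2 * ‖w - c‖ ^ 2 := by
  have hd : DifferentiableAt ℂ f c := hf.differentiableAt (Metric.ball_mem_nhds c hR)
  have hM0 : 0 ≤ M := (norm_nonneg _).trans (hM c (Metric.mem_ball_self hR))
  -- The Schwarz lemma of order two for `f` minus its linear part.
  have key := Complex.dist_le_mul_div_pow_of_mapsTo_ball_of_isLittleO (n := 1)
    (f := fun z => f z - fderiv ℂ f c (z - c)) (c := c) (z := w) (R₁ := R) (R₂ := 4 * M)
    (hf.sub ((fderiv ℂ f c).differentiable.comp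
      (differentiable_id.sub_const c)).differentiableOn) ?_ ?_ hw
  · rw [dist_eq_norm, dist_eq_norm] at key
    simp only [sub_self, map_zero, sub_zero] at key
    rw [sub_right_comm]
    refine key.trans_eq ?_
    rw [div_pow]; ring
  · intro z hz
    have h1 := hM z hz
    have h2 := hM c (Metric.mem_ball_self hR)
    have h3 : ‖fderiv ℂ f c (z - c)‖ ≤ 2 * M := by
      have hz' : ‖z - c‖ ≤ R := (mem_ball_iff_norm.mp hz).le
      calc ‖fderiv ℂ f c (z - c)‖ ≤ 2 * M / R * R :=
            (fderiv ℂ f c).le_of_opNorm_le_of_le (norm_fderiv_le_of_bounded hR hf hM) hz'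
        _ = 2 * M := by field_simp
    rw [mem_closedBall_iff_norm]
    simp only [sub_self, map_zero, sub_zero]
    linarith [norm_sub_le (f z - fderiv ℂ f c (z - c)) (f c),
      norm_sub_le (f z) (fderiv ℂ f c (z - c))]
  · have := hd.hasFDerivAt.isLittleO
    simp only [sub_self, map_zero, sub_zero, pow_one]
    refine (this.congr_left fun z => ?_).norm_right
    abel

lemma hasFDerivAt_of_norm_sub_le_sq {f : F → E} {f' : F →L[ℂ] E} {c : F} {R C : ℝ} (hR : 0 < R)
    (h : ∀ w ∈ Metric.ball c R, ‖f w - f c - f' (w - c)‖ ≤ C * ‖w - c‖ ^ 2) :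
    HasFDerivAt f f' c := by
  refine .of_isLittleO ?_
  have h1 : (fun w => f w - f c - f' (w - c)) =O[𝓝 c] fun w => ‖w - c‖ ^ 2 := by
    refine Asymptotics.IsBigO.of_bound C ?_
    filter_upwards [Metric.ball_mem_nhds c hR] with w hw
    simpa using h w hw
  refine h1.trans_isLittleO ?_
  have h2 := Asymptotics.isLittleO_norm_pow_id (E' := F) one_lt_two
  have h3 : Tendsto (fun w : F => w - c) (𝓝 c) (𝓝 0) := by
    simpa using (continuous_id.sub continuous_const).tendsto (x := c) (f := fun w : F => w - c)
  exact h2.comp_tendsto h3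

open scoped BoundedContinuousFunction

/-- A bounded sequence of holomorphic maps `f k` on an open set `B`, viewed as one map `Φ` into the
Banach space of bounded sequences, is holomorphic, and its derivative is computed termwise. -/
lemma exists_hasFDerivAt_boundedSeq {f : ℕ → F → E} {B : Set F} {M : ℝ} (hB : IsOpen B)
    (hf : ∀ k, DifferentiableOn ℂ (f k) B) (hM : ∀ k, ∀ w ∈ B, ‖f k w‖ ≤ M) :
    ∃ Φ : F → ℕ →ᵇ E, (∀ w ∈ B, ∀ k, Φ w k = f k w) ∧ (∀ w ∉ B, Φ w = 0) ∧
      ∀ c ∈ B, ∃ L : F →L[ℂ] ℕ →ᵇ E, HasFDerivAt Φ L c ∧ ∀ h k, L h k = fderiv ℂ (f k) c h := by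
  classical
  let Φ : F → ℕ →ᵇ E := fun w => if hw : w ∈ B then
    .ofNormedAddCommGroupDiscrete (fun k => f k w) M (fun k => hM k w hw) else 0
  have hΦ : ∀ w ∈ B, ∀ k, Φ w k = f k w := fun w hw k => by simp [Φ, hw]
  refine ⟨Φ, hΦ, fun w hw => by simp [Φ, hw], fun c hc => ?_⟩
  obtain ⟨R, hR, hRB⟩ := Metric.isOpen_iff.mp hB c hc
  have hM0 : 0 ≤ M := (norm_nonneg _).trans (hM 0 c hc)
  replace hf k := (hf k).mono hRB
  replace hM k w hw := hM k w (hRB hw)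
  have hL : ∀ (h : F) (k : ℕ), ‖fderiv ℂ (f k) c h‖ ≤ 2 * M / R * ‖h‖ := fun h k =>
    (fderiv ℂ (f k) c).le_of_opNorm_le (norm_fderiv_le_of_bounded hR (hf k) (hM k)) h
  let L : F →ₗ[ℂ] ℕ →ᵇ E :=
    { toFun := fun h => .ofNormedAddCommGroupDiscrete (fun k => fderiv ℂ (f k) c h) _ (hL h)
      map_add' := fun h₁ h₂ => by ext k; simp
      map_smul' := fun a h => by ext k; simp }
  refine ⟨L.mkContinuous (2 * M / R) fun h => ?_, hasFDerivAt_of_norm_sub_le_sq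
    (C := 4 * M / R ^ 2) hR fun w hw => ?_, fun h k => rfl⟩
  · exact (BoundedContinuousFunction.norm_le (by positivity)).mpr (hL h)
  · refine (BoundedContinuousFunction.norm_le (by positivity)).mpr fun k => ?_
    have := norm_sub_sub_fderiv_le_of_bounded hR (hf k) (hM k) hw
    simpa [L, hΦ w (hRB hw), hΦ c hc] using this

variable (E) in
/-- The convergent sequences, as a subspace of the Banach space of bounded sequences in `E`. -/
def convergentSeq : Submodule ℂ (ℕ →ᵇ E) where
  carrier := {u | ∃ l, Tendsto u atTop (𝓝 l)}
  add_mem' := by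
    rintro u v ⟨l, hl⟩ ⟨m, hm⟩
    exact ⟨l + m, hl.add hm⟩
  zero_mem' := ⟨0, tendsto_const_nhds⟩
  smul_mem' := by
    rintro a u ⟨l, hl⟩
    exact ⟨a • l, hl.const_smul a⟩

lemma isClosed_convergentSeq [CompleteSpace E] : IsClosed (convergentSeq E : Set (ℕ →ᵇ E)) := by
  refine isClosed_of_closure_subset fun u hu => cauchySeq_tendsto_of_complete ?_
  rw [Metric.cauchySeq_iff]
  intro ε hε
  obtain ⟨v, ⟨l, hl⟩, hv⟩ := Metric.mem_closure_iff.mp hu (ε / 3) (by positivity)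
  obtain ⟨N, hN⟩ := Metric.cauchySeq_iff.mp hl.cauchySeq (ε / 3) (by positivity)
  refine ⟨N, fun m hm n hn => ?_⟩
  have h1 := (BoundedContinuousFunction.dist_coe_le_dist (f := u) (g := v) m)
  have h2 := (BoundedContinuousFunction.dist_coe_le_dist (f := u) (g := v) n)
  have h3 := dist_triangle4 (u m) (v m) (v n) (u n)
  rw [dist_comm (v n)] at h3
  linarith [hN m hm n hn]

/-- A bounded pointwise limit of holomorphic maps between Banach spaces is holomorphic. Derivatives
need not converge in norm here, as balls are not compact. They do converge pointwise, since the
derivative of the induced map into bounded sequences takes its values in the closed subspace of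
convergent ones. -/
lemma differentiableOn_of_tendsto [CompleteSpace E] [CompleteSpace F] {f : ℕ → F → E} {g : F → E}
    {B : Set F} {M : ℝ} (hB : IsOpen B) (hf : ∀ k, DifferentiableOn ℂ (f k) B)
    (hM : ∀ k, ∀ w ∈ B, ‖f k w‖ ≤ M)
    (hg : ∀ w ∈ B, Tendsto (fun k => f k w) atTop (𝓝 (g w))) : DifferentiableOn ℂ g B := by
  intro c hc
  obtain ⟨Φ, hΦ, hΦ0, hΦd⟩ := exists_hasFDerivAt_boundedSeq hB hf hM
  obtain ⟨L, hL, hLk⟩ := hΦd c hc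
  have hΦmem : ∀ w, Φ w ∈ convergentSeq E := by
    intro w
    by_cases hw : w ∈ B
    · exact ⟨g w, (hg w hw).congr fun k => (hΦ w hw k).symm⟩
    · exact hΦ0 w hw ▸ Submodule.zero_mem _
  have hLmem : ∀ h, ∃ l, Tendsto (fun k => fderiv ℂ (f k) c h) atTop (𝓝 l) := by
    intro h
    have : L h ∈ convergentSeq E :=
      isClosed_convergentSeq.mem_of_tendsto (hL.hasLineDerivAt h).tendsto_slope_zero
        (Eventually.of_forall fun t =>
          Submodule.smul_mem _ _ (Submodule.sub_mem _ (hΦmem _) (hΦmem _)))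
    obtain ⟨l, hl⟩ := this
    exact ⟨l, hl.congr fun k => hLk h k⟩
  choose D hD using hLmem
  obtain ⟨R, hR, hRB⟩ := Metric.isOpen_iff.mp hB c hc
  refine (hasFDerivAt_of_norm_sub_le_sq (C := 4 * M / R ^ 2)
    (f' := continuousLinearMapOfTendsto (fun k => fderiv ℂ (f k) c) (tendsto_pi_nhds.mpr hD)) hR
    fun w hw => ?_).differentiableAt.differentiableWithinAt
  exact le_of_tendsto' (((hg w (hRB hw)).sub (hg c hc)).sub (hD (w - c))).norm fun k =>
    norm_sub_sub_fderiv_le_of_bounded hR ((hf k).mono hRB) (fun z hz => hM k z (hRB hz)) hw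

/-- **Vitali's theorem** in Banach spaces: a bounded sequence of holomorphic maps which converges
pointwise on a set of uniqueness for scalar holomorphic functions converges everywhere. The
composition of the induced holomorphic map into bounded sequences with any continuous functional
killing the convergent sequences vanishes on the set of uniqueness, hence identically. -/
lemma exists_tendsto_of_uniqueness [CompleteSpace E] {f : ℕ → F → E} {B : Set F} {M : ℝ}
    (hB : IsOpen B) (hf : ∀ k, DifferentiableOn ℂ (f k) B) (hM : ∀ k, ∀ w ∈ B, ‖f k w‖ ≤ M)
    (huniq : ∀ g : F → ℂ, DifferentiableOn ℂ g B →
      (∀ w ∈ B, (∃ l, Tendsto (fun k => f k w) atTop (𝓝 l)) → g w = 0) → ∀ w ∈ B, g w = 0)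
    {w : F} (hw : w ∈ B) : ∃ l, Tendsto (fun k => f k w) atTop (𝓝 l) := by
  obtain ⟨Φ, hΦ, -, hΦd⟩ := exists_hasFDerivAt_boundedSeq hB hf hM
  have hmem : ∀ w ∈ B, (Φ w ∈ convergentSeq E ↔ ∃ l, Tendsto (fun k => f k w) atTop (𝓝 l)) := by
    intro w hw
    rw [← show (Φ w : ℕ → E) = fun k => f k w from funext (hΦ w hw)]
    rfl
  rw [← hmem w hw, ← Submodule.Quotient.mk_eq_zero]
  have : IsClosed (convergentSeq E : Set (ℕ →ᵇ E)) := isClosed_convergentSeq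
  refine SeparatingDual.eq_zero_of_forall_dual_eq_zero (R := ℂ) fun φ => ?_
  refine huniq (fun w => φ ((convergentSeq E).mkQL (Φ w))) ?_ ?_ w hw
  · exact (φ.comp (convergentSeq E).mkQL).differentiable.comp_differentiableOn fun c hc =>
      (hΦd c hc).choose_spec.1.differentiableAt.differentiableWithinAt
  · intro z hz hl
    have : (convergentSeq E).mkQL (Φ z) = 0 :=
      (Submodule.Quotient.mk_eq_zero _).mpr ((hmem z hz).mpr hl)
    simp only [this, map_zero]

/-- The identity theorem on a convex open set, by restriction to complex lines. -/
lemma eq_zero_of_eventuallyEq_zero_of_convex {g : F → ℂ} {B : Set F} (hB : IsOpen B)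
    (hconv : Convex ℝ B) (hg : DifferentiableOn ℂ g B) {c : F} (hc : c ∈ B)
    (h0 : ∀ᶠ w in 𝓝 c, g w = 0) {w : F} (hw : w ∈ B) : g w = 0 := by
  let l : ℂ → F := AffineMap.lineMap c w
  have hl : Differentiable ℂ l := (AffineMap.lineMap c w : ℂ →ᵃ[ℂ] F).differentiable
  have hopen : IsOpen (l ⁻¹' B) := hB.preimage hl.continuous
  have hpre : IsPreconnected (l ⁻¹' B) := by
    have : Convex ℝ (l ⁻¹' B) := hconv.affine_preimage
      (((LinearMap.toSpanSingleton ℂ F (w - c)).restrictScalars ℝ).toAffineMap +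
        AffineMap.const ℝ ℂ c)
    exact this.isPreconnected
  have han : AnalyticOnNhd ℂ (g ∘ l) (l ⁻¹' B) :=
    (hg.comp hl.differentiableOn fun _ h => h).analyticOnNhd hopen
  have hl0 : l 0 = c := AffineMap.lineMap_apply_zero c w
  have hl1 : l 1 = w := AffineMap.lineMap_apply_one c w
  have hev : (g ∘ l) =ᶠ[𝓝 0] 0 := by
    have : Tendsto l (𝓝 0) (𝓝 c) := hl0 ▸ hl.continuous.tendsto 0
    exact this.eventually h0
  have := han.eqOn_zero_of_preconnected_of_eventuallyEq_zero hpre (z₀ := 0)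
    (by simpa [hl0] using hc) hev (x := 1) (by simpa [hl1] using hw)
  simpa [hl1] using this

end Banach

/-! ### Equicontinuous sequences in complete uniform spaces -/

section Equicontinuous

variable {A X : Type*} [TopologicalSpace A] [UniformSpace X] {f : ℕ → A → X}

lemma Equicontinuous.isClosed_convergenceSet [CompleteSpace X] (hf : Equicontinuous f) :
    IsClosed (convergenceSet f) := by
  refine isClosed_of_closure_subset fun a ha => cauchySeq_tendsto_of_complete ?_
  rw [cauchySeq_iff]
  intro V hV
  obtain ⟨W, hW, hWsymm, hWV⟩ := comp_comp_symm_mem_uniformity_sets hV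
  obtain ⟨b, hb, hbZ⟩ := mem_closure_iff_nhds.mp ha _ (hf a W hW)
  obtain ⟨x, hx⟩ := hbZ
  obtain ⟨N, hN⟩ := cauchySeq_iff.mp hx.cauchySeq W hW
  exact ⟨N, fun k hk l hl => hWV ⟨f l b, ⟨f k b, hb k, hN k hk l hl⟩, hWsymm.symm _ _ (hb l)⟩⟩

lemma EquicontinuousAt.tendsto_prod {a : A} (hf : EquicontinuousAt f a) {x : X}
    (hx : Tendsto (fun k => f k a) atTop (𝓝 x)) :
    Tendsto (fun p : ℕ × A => f p.1 p.2) (atTop ×ˢ 𝓝 a) (𝓝 x) := by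
  rw [Uniform.tendsto_nhds_right, tendsto_def]
  intro V hV
  obtain ⟨W, hW, hWV⟩ := comp_mem_uniformity_sets hV
  have hxW : ∀ᶠ k in atTop, (x, f k a) ∈ W := Uniform.tendsto_nhds_right.mp hx hW
  filter_upwards [hxW.prod_mk (hf W hW)] with p hp
  exact hWV ⟨f p.1 a, hp.1, hp.2 p.1⟩

lemma Equicontinuous.tendstoLocallyUniformly (hf : Equicontinuous f) {g : A → X}
    (hg : ∀ a, Tendsto (fun k => f k a) atTop (𝓝 (g a))) : TendstoLocallyUniformly f g atTop := by
  intro V hV a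
  obtain ⟨W, hW, hWsymm, hWV⟩ := comp_comp_symm_mem_uniformity_sets hV
  obtain ⟨W', hW', hW'c, hW'W⟩ := mem_uniformity_isClosed hW
  refine ⟨_, hf a W' hW', ?_⟩
  filter_upwards [Uniform.tendsto_nhds_right.mp (hg a) hW] with k hk b hb
  have : (g a, g b) ∈ W := hW'W
    (hW'c.mem_of_tendsto ((hg a).prodMk_nhds (hg b)) (Eventually.of_forall hb))
  exact hWV ⟨f k a, ⟨g a, hWsymm.symm _ _ this, hk⟩, hW'W (hb k)⟩

end Equicontinuous

/-! ### Holomorphic maps into a hyperbolic manifold -/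

section Manifold

lemma exists_chart_ball_subset_of_mem_nhds {F A : Type*} [NormedAddCommGroup F] [TopologicalSpace A]
    [ChartedSpace F A] {a : A} {s : Set F} (hs : s ∈ 𝓝 (chartAt F a a)) :
    ∃ r > 0, Metric.ball (chartAt F a a) r ⊆ s ∩ (chartAt F a).target :=
  Metric.mem_nhds_iff.mp (inter_mem hs ((chartAt F a).open_target.mem_nhds (mem_chart_target F a)))

variable {E F : Type*} [NormedAddCommGroup E] [NormedSpace ℂ E]
  [NormedAddCommGroup F] [NormedSpace ℂ F] {A : Type*} [TopologicalSpace A] [ChartedSpace F A]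

/-- Around a limit point of the interior of `S`, scalar holomorphic functions on a chart ball are
determined by their values on `S`, by the identity theorem. -/
lemma eq_zero_on_chart_ball_of_mem_closure_interior {S : Set A} {a : A}
    (ha : a ∈ closure (interior S)) {r : ℝ} (hr : 0 < r) {g : F → ℂ}
    (hg : DifferentiableOn ℂ g (Metric.ball (chartAt F a a) r))
    (h0 : ∀ w ∈ Metric.ball (chartAt F a a) r, (chartAt F a).symm w ∈ S → g w = 0) :
    ∀ w ∈ Metric.ball (chartAt F a a) r, g w = 0 := by
  set φ := chartAt F a
  obtain ⟨b, ⟨hbs, hbB⟩, hbS⟩ := mem_closure_iff.mp ha _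
    (φ.isOpen_inter_preimage (s := Metric.ball (φ a) r) Metric.isOpen_ball)
    ⟨mem_chart_source F a, Metric.mem_ball_self hr⟩
  have hev : ∀ᶠ w in 𝓝 (φ b), g w = 0 := by
    have hc : Tendsto φ.symm (𝓝 (φ b)) (𝓝 b) := φ.tendsto_symm hbs
    filter_upwards [hc (isOpen_interior.mem_nhds hbS), Metric.isOpen_ball.mem_nhds hbB]
      with w hw hwB
    exact h0 w hwB (interior_subset hw)
  exact fun w hw => eq_zero_of_eventuallyEq_zero_of_convex Metric.isOpen_ball
    (convex_ball (φ a) r) hg hbB hev hw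

variable [IsManifold 𝓘(ℂ, F) ω A]

/-- Holomorphic maps `A → X` decrease distances: near `a`, the distance of `f a` and `f b` is at
most the Poincaré distance in a disc of fixed radius in a chart, whatever the map `f`. -/
lemma eventually_kobayashiDist_lt {X : Type*} [TopologicalSpace X] [ChartedSpace E X]
    (a : A) {ε : ℝ≥0∞} (hε : 0 < ε) :
    ∀ᶠ b in 𝓝 a, ∀ f : A → X, MDifferentiable 𝓘(ℂ, F) 𝓘(ℂ, E) f →
      kobayashiDist E (f a) (f b) < ε := by
  set φ := chartAt F a
  obtain ⟨r, hr, hball⟩ := exists_chart_ball_subset_of_mem_nhds (F := F) (a := a) univ_mem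
  replace hball := hball.trans inter_subset_right
  let t : A → ℝ := fun b => ‖φ b - φ a‖ / r
  have ht : Tendsto t (𝓝 a) (𝓝 0) := by
    have : Tendsto φ (𝓝 a) (𝓝 (φ a)) := φ.continuousAt (mem_chart_source F a)
    simpa [t] using ((this.sub_const (φ a)).norm.div_const r)
  have hlog : Tendsto (fun b => ENNReal.ofReal (Real.log ((1 + t b) / (1 - t b)))) (𝓝 a) (𝓝 0) := by
    have h1 : Tendsto (fun b => (1 + t b) / (1 - t b)) (𝓝 a) (𝓝 1) := by
      simpa [Pi.div_def] using (ht.const_add 1).div (ht.const_sub 1) (by norm_num)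
    simpa using ENNReal.tendsto_ofReal (h1.log one_ne_zero)
  filter_upwards [hlog.eventually (gt_mem_nhds hε), ht.eventually (gt_mem_nhds one_pos),
    φ.open_source.mem_nhds (mem_chart_source F a)] with b hb ht1 hbs f hf
  have ht0 : 0 ≤ t b := by positivity
  -- The disc of radius `r` in the direction of `φ b - φ a`; it is constant if `φ b = φ a`.
  let l : ℂ → F := fun ζ => φ a + ζ • (((r / ‖φ b - φ a‖ : ℝ) : ℂ) • (φ b - φ a))
  have hl : Differentiable ℂ l := by fun_prop
  have hlball : MapsTo l (Metric.ball 0 1) (Metric.ball (φ a) r) := by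
    intro ζ hζ
    rw [mem_ball_iff_norm, show l ζ - φ a = ζ • (((r / ‖φ b - φ a‖ : ℝ) : ℂ) • (φ b - φ a)) by
      simp [l]]
    rcases eq_or_ne (φ b - φ a) 0 with h | h
    · simpa [h] using hr
    · have h' : ‖φ b - φ a‖ ≠ 0 := norm_ne_zero_iff.mpr h
      have hζ1 : ‖ζ‖ < 1 := by simpa using hζ
      rw [norm_smul, norm_smul, Complex.norm_real, Real.norm_of_nonneg (by positivity),
        div_mul_cancel₀ _ h']
      nlinarith
  have hl0 : l 0 = φ a := by simp [l]
  have hlt : l (t b : ℂ) = φ b := by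
    rcases eq_or_ne (φ b - φ a) 0 with h | h
    · simp [l, sub_eq_zero.mp h]
    · have h' : ((‖φ b - φ a‖ : ℝ) : ℂ) ≠ 0 := by exact_mod_cast norm_ne_zero_iff.mpr h
      have hr' : (r : ℂ) ≠ 0 := by exact_mod_cast hr.ne'
      simp only [l, t, smul_smul, Complex.ofReal_div]
      rw [div_mul_div_cancel₀ hr', div_self h', one_smul, add_sub_cancel]
  have hh : MDifferentiableOn 𝓘(ℂ, ℂ) 𝓘(ℂ, E) (fun ζ => f (φ.symm (l ζ))) (Metric.ball 0 1) :=
    hf.comp_mdifferentiableOn (((mdifferentiable_chart (I := 𝓘(ℂ, F)) (H := F) a).2).comp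
      hl.differentiableOn.mdifferentiableOn fun ζ hζ => hball (hlball hζ))
  have key := kobayashiDist_le_poincareDist hh (a := 0) (b := t b) (by simp)
    (by simpa [abs_of_nonneg ht0] using ht1)
  rw [hl0, hlt, φ.left_inv (mem_chart_source F a), φ.left_inv hbs,
    poincareDist_zero_ofReal ht0] at key
  exact key.trans_lt hb

/-- Scalar holomorphic functions on a chart ball around a point of `Sᵘ` are determined by their
values on `S`. -/
lemma eq_zero_on_chart_ball_of_mem_uniquenessPart {S : Set A} {a : A}
    (ha : a ∈ uniquenessPart F S) {r : ℝ} (hr : 0 < r)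
    (hball : Metric.ball (chartAt F a a) r ⊆ (chartAt F a).target) {g : F → ℂ}
    (hg : DifferentiableOn ℂ g (Metric.ball (chartAt F a a) r))
    (h0 : ∀ w ∈ Metric.ball (chartAt F a a) r, (chartAt F a).symm w ∈ S → g w = 0) :
    ∀ w ∈ Metric.ball (chartAt F a a) r, g w = 0 := by
  set φ := chartAt F a
  have hU := φ.symm_image_eq_source_inter_preimage hball
  have hconn : IsConnected (φ.symm '' Metric.ball (φ a) r) :=
    ((convex_ball (φ a) r).isConnected (Metric.nonempty_ball.mpr hr)).image _
      (φ.continuousOn_symm.mono hball)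
  have hmaps : MapsTo φ (φ.symm '' Metric.ball (φ a) r) (Metric.ball (φ a) r) := by
    rw [hU]; exact fun b hb => hb.2
  have key := ha.2 (φ.symm '' Metric.ball (φ a) r)
    (hU ▸ φ.isOpen_inter_preimage Metric.isOpen_ball) hconn
    (hU ▸ ⟨mem_chart_source F a, Metric.mem_ball_self hr⟩) (g ∘ φ)
    (hg.mdifferentiableOn.comp ((mdifferentiable_chart (I := 𝓘(ℂ, F)) a).1.mono
      (hU ▸ inter_subset_left)) hmaps) ?_
  · intro w hw
    simpa [φ.right_inv (hball hw)] using key (φ.symm w) (mem_image_of_mem _ hw)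
  · rintro _ ⟨⟨w, hw, rfl⟩, hS⟩
    simpa [φ.right_inv (hball hw)] using h0 w hw hS

variable {X : Type*} [UniformSpace X] [ChartedSpace E X] [IsManifold 𝓘(ℂ, E) ω X]
  {f : ℕ → A → X}

/-- Near a point of convergence, the tail of an equicontinuous sequence of holomorphic maps is
given in charts by a bounded sequence of holomorphic maps between open sets of Banach spaces. The
values stay in a closed set `C` inside the domain of the chart `ψ` of `X`, so that pointwise
convergence in `X` and in `E` are the same. -/
lemma Equicontinuous.exists_local_representation (hequi : Equicontinuous f)
    (hf : ∀ k, MDifferentiable 𝓘(ℂ, F) 𝓘(ℂ, E) (f k)) {a : A} (ha : a ∈ convergenceSet f) :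
    ∃ r > 0, Metric.ball (chartAt F a a) r ⊆ (chartAt F a).target ∧
      ∃ (N : ℕ) (M : ℝ), ∃ ψ ∈ atlas E X, ∃ C : Set X, IsClosed C ∧ C ⊆ ψ.source ∧
      (∀ k, ∀ w ∈ Metric.ball (chartAt F a a) r, f (k + N) ((chartAt F a).symm w) ∈ C) ∧
      (∀ k, DifferentiableOn ℂ (fun w => ψ (f (k + N) ((chartAt F a).symm w)))
        (Metric.ball (chartAt F a a) r)) ∧
      (∀ k, ∀ w ∈ Metric.ball (chartAt F a a) r,
        ‖ψ (f (k + N) ((chartAt F a).symm w))‖ ≤ M) ∧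
      (∀ w ∈ Metric.ball (chartAt F a a) r,
        (∃ l, Tendsto (fun k => ψ (f (k + N) ((chartAt F a).symm w))) atTop (𝓝 l)) ↔
          (chartAt F a).symm w ∈ convergenceSet f) := by
  obtain ⟨x, hx⟩ := ha
  set φ := chartAt F a
  set ψ := chartAt E x
  have hxs : x ∈ ψ.source := mem_chart_source E x
  obtain ⟨ρ, hρ, hρt⟩ := Metric.nhds_basis_closedBall.mem_iff.mp
    (ψ.open_target.mem_nhds (mem_chart_target E x))
  obtain ⟨C, hCx, hCc, hC⟩ := exists_mem_nhds_isClosed_subset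
    (inter_mem (ψ.open_source.mem_nhds hxs)
      (ψ.continuousAt hxs (Metric.closedBall_mem_nhds (ψ x) hρ)))
  obtain ⟨P, hP, Q, hQ, hPQ⟩ := eventually_prod_iff.mp ((hequi a).tendsto_prod hx hCx)
  obtain ⟨N, hN⟩ := eventually_atTop.mp hP
  have hφa : Tendsto φ.symm (𝓝 (φ a)) (𝓝 a) := φ.tendsto_symm (mem_chart_source F a)
  obtain ⟨r, hr, hball⟩ := exists_chart_ball_subset_of_mem_nhds (hφa.eventually hQ)
  have hmem : ∀ k, ∀ w ∈ Metric.ball (φ a) r, f (k + N) (φ.symm w) ∈ C := fun k w hw =>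
    hPQ (hN (k + N) (by omega)) (hball hw).1
  refine ⟨r, hr, hball.trans inter_subset_right, N, ‖ψ x‖ + ρ, ψ, chart_mem_atlas E x, C, hCc,
    hC.trans inter_subset_left, hmem, fun k => ?_, fun k w hw => ?_, fun w hw => ⟨?_, ?_⟩⟩
  · rw [← mdifferentiableOn_iff_differentiableOn]
    exact (mdifferentiable_chart (I := 𝓘(ℂ, E)) x).1.comp
      ((hf _).comp_mdifferentiableOn ((mdifferentiable_chart (I := 𝓘(ℂ, F)) a).2.mono
        (hball.trans inter_subset_right))) fun w hw => (hC (hmem k w hw)).1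
  · have := mem_closedBall_iff_norm.mp (hC (hmem k w hw)).2
    linarith [norm_sub_norm_le (ψ (f (k + N) (φ.symm w))) (ψ x)]
  · rintro ⟨l, hl⟩
    have hlt : l ∈ ψ.target := hρt (Metric.isClosed_closedBall.mem_of_tendsto hl
      (Eventually.of_forall fun k => (hC (hmem k w hw)).2))
    refine ⟨ψ.symm l, (tendsto_add_atTop_iff_nat N).mp ?_⟩
    exact ((ψ.symm.continuousAt hlt).tendsto.comp hl).congr fun k =>
      ψ.left_inv (hC (hmem k w hw)).1
  · rintro ⟨y, hy⟩
    have hy' := (tendsto_add_atTop_iff_nat N).mpr hy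
    have hyC : y ∈ C := hCc.mem_of_tendsto hy' (Eventually.of_forall fun k => hmem k w hw)
    exact ⟨ψ y, (ψ.continuousAt (hC hyC).1).tendsto.comp hy'⟩

/-- Vitali's theorem near a point of convergence. -/
lemma Equicontinuous.mem_interior_convergenceSet [CompleteSpace E] (hequi : Equicontinuous f)
    (hf : ∀ k, MDifferentiable 𝓘(ℂ, F) 𝓘(ℂ, E) (f k)) {a : A} (ha : a ∈ convergenceSet f)
    (huniq : ∀ r > 0, Metric.ball (chartAt F a a) r ⊆ (chartAt F a).target → ∀ g : F → ℂ,
      DifferentiableOn ℂ g (Metric.ball (chartAt F a a) r) →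
      (∀ w ∈ Metric.ball (chartAt F a a) r, (chartAt F a).symm w ∈ convergenceSet f → g w = 0) →
      ∀ w ∈ Metric.ball (chartAt F a a) r, g w = 0) :
    a ∈ interior (convergenceSet f) := by
  obtain ⟨r, hr, hball, N, M, ψ, -, C, -, -, -, hdiff, hM, hconv⟩ :=
    hequi.exists_local_representation hf ha
  rw [mem_interior_iff_mem_nhds]
  have hφa : Tendsto (chartAt F a) (𝓝 a) (𝓝 (chartAt F a a)) :=
    (chartAt F a).continuousAt (mem_chart_source F a)
  filter_upwards [hφa (Metric.ball_mem_nhds _ hr),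
    (chartAt F a).open_source.mem_nhds (mem_chart_source F a)] with b hb hbs
  rw [← (chartAt F a).left_inv hbs, ← hconv _ hb]
  exact exists_tendsto_of_uniqueness Metric.isOpen_ball hdiff hM
    (fun g hg h0 => huniq r hr hball g hg fun w hw hwS => h0 w hw ((hconv w hw).mpr hwS)) hb

lemma Equicontinuous.mdifferentiable_of_tendsto [CompleteSpace E] [CompleteSpace F]
    (hequi : Equicontinuous f) (hf : ∀ k, MDifferentiable 𝓘(ℂ, F) 𝓘(ℂ, E) (f k)) {g : A → X}
    (hg : ∀ a, Tendsto (fun k => f k a) atTop (𝓝 (g a))) :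
    MDifferentiable 𝓘(ℂ, F) 𝓘(ℂ, E) g := by
  intro a
  obtain ⟨r, hr, hball, N, M, ψ, hψ, C, hCc, hC, hmem, hdiff, hM, -⟩ :=
    hequi.exists_local_representation hf ⟨g a, hg a⟩
  set φ := chartAt F a
  have has : a ∈ φ.source := mem_chart_source F a
  have hgN : ∀ b, Tendsto (fun k => f (k + N) b) atTop (𝓝 (g b)) := fun b =>
    (tendsto_add_atTop_iff_nat N).mpr (hg b)
  have hgC : ∀ w ∈ Metric.ball (φ a) r, g (φ.symm w) ∈ C := fun w hw =>
    hCc.mem_of_tendsto (hgN _) (Eventually.of_forall fun k => hmem k w hw)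
  have hd : DifferentiableOn ℂ (fun w => ψ (g (φ.symm w))) (Metric.ball (φ a) r) :=
    differentiableOn_of_tendsto Metric.isOpen_ball hdiff hM fun w hw =>
      (ψ.continuousAt (hC (hgC w hw))).tendsto.comp (hgN _)
  have haB : φ a ∈ Metric.ball (φ a) r := Metric.mem_ball_self hr
  have h1 : MDifferentiableAt 𝓘(ℂ, F) 𝓘(ℂ, E) (fun w => ψ (g (φ.symm w))) (φ a) :=
    (hd.differentiableAt (Metric.isOpen_ball.mem_nhds haB)).mdifferentiableAt
  have h2 : MDifferentiableAt 𝓘(ℂ, E) 𝓘(ℂ, E) ψ.symm (ψ (g (φ.symm (φ a)))) :=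
    mdifferentiableAt_atlas_symm hψ (ψ.map_source (hC (hgC _ haB)))
  have h3 : MDifferentiableAt 𝓘(ℂ, F) 𝓘(ℂ, F) φ a :=
    mdifferentiableAt_atlas (chart_mem_atlas F a) has
  refine ((h2.comp (φ a) h1).comp a h3).congr_of_eventuallyEq ?_
  filter_upwards [φ.continuousAt has (Metric.isOpen_ball.mem_nhds haB),
    φ.open_source.mem_nhds has] with b hb hbs
  have := ψ.left_inv (hC (hgC _ hb))
  rw [φ.left_inv hbs] at this
  simp [φ.left_inv hbs, this]

end Manifold

/-- The strong Vitali property needs completeness of the Kobayashi distance only. The set of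
convergence is closed, its interior is closed by the identity theorem and nonempty by the
hypothesis on the uniqueness part, so it is all of the connected manifold. -/
lemma IsHyperbolic.strongVitali {E : Type u} [NormedAddCommGroup E] [NormedSpace ℂ E]
    [CompleteSpace E] {X : Type v} [TopologicalSpace X] [ChartedSpace E X]
    [IsManifold 𝓘(ℂ, E) ω X] (hX : IsHyperbolic E X)
    (hc : @CompleteSpace X hX.emetricSpace.toUniformSpace) : StrongVitali.{u, v, w, t} E X := by
  let _ : EMetricSpace X := hX.emetricSpace
  intro F _ _ _ A _ _ _ _ f hne
  have hf : ∀ k, MDifferentiable 𝓘(ℂ, F) 𝓘(ℂ, E) (f k).1 := fun k => (f k).2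
  have hequi : Equicontinuous fun k a => (f k).1 a := by
    intro a V hV
    obtain ⟨ε, hε, hεV⟩ := mem_uniformity_edist.mp hV
    filter_upwards [eventually_kobayashiDist_lt (E := E) (F := F) (X := X) a hε] with b hb k
    exact hεV (hb _ (hf k))
  set Z := convergenceSet fun k a => (f k).1 a
  have hZ : IsClosed Z := hequi.isClosed_convergenceSet
  have hint : IsClosed (interior Z) := isClosed_of_closure_subset fun a ha =>
    hequi.mem_interior_convergenceSet hf (closure_minimal interior_subset hZ ha)
      fun r hr _ g hg => eq_zero_on_chart_ball_of_mem_closure_interior ha hr hg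
  have hintne : (interior Z).Nonempty := by
    obtain ⟨a, ha⟩ := hne
    exact ⟨a, hequi.mem_interior_convergenceSet hf (hZ.closure_subset ha.1)
      fun r hr hball g hg => eq_zero_on_chart_ball_of_mem_uniquenessPart ha hr hball hg⟩
  have huniv : interior Z = univ := IsClopen.eq_univ ⟨hint, isOpen_interior⟩ hintne
  have hconv : ∀ a, ∃ x, Tendsto (fun k => (f k).1 a) atTop (𝓝 x) := fun a =>
    interior_subset (s := Z) (huniv ▸ mem_univ a)
  choose g hg using hconv
  have hloc : TendstoLocallyUniformly (fun k a => (f k).1 a) g atTop :=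
    hequi.tendstoLocallyUniformly hg
  refine ⟨⟨⟨g, hloc.continuous (Frequently.of_forall fun k => (f k).1.continuous)⟩,
    hequi.mdifferentiable_of_tendsto hf hg⟩, ?_⟩
  exact tendsto_subtype_rng.mpr (ContinuousMap.tendsto_of_tendstoLocallyUniformly hloc)

theorem theorem3p3 (E : Type u) [NormedAddCommGroup E] [NormedSpace ℂ E]
    [CompleteSpace E] (X : Type v) [TopologicalSpace X] [ChartedSpace E X]
    [IsManifold 𝓘(ℂ, E) ω X] :
    (IsCompleteHyperbolic E X → StrongVitali.{u, v, w, t} E X) ∧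
      (CompactSpace X → IsHyperbolic E X → StrongVitali.{u, v, w, t} E X) := by
  refine ⟨fun hX => hX.toIsHyperbolic.strongVitali ?_, fun _ hX => hX.strongVitali ?_⟩
  · let _ : EMetricSpace X := hX.toIsHyperbolic.emetricSpace
    exact EMetric.complete_of_cauchySeq_tendsto fun u hu =>
      hX.exists_lim u fun ε hε => EMetric.cauchySeq_iff.mp hu ε hε
  · let _ : EMetricSpace X := hX.emetricSpace
    infer_instance
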